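/- **Theorem (power iteration with maximum norm).** Let $\mathcal R$ (resp. $\mathcal C$) be the real (resp. complex) Levi-Civita field, i.e. the field of functions $a:\mathbb Q\to\mathbb R$ (resp. $\mathbb C$), $q\mapsto a[q]$, whose support is left-finite (finitely many support points below every rational), with componentwise addition and the product $(ab)[q]=\sum_{q_1+q_2=q}a[q_1]\,b[q_2]$. Write $\lambda(a)=\min\operatorname{supp}(a)$ (with $\lambda(0)=\infty$) and call $a$ *at most finite* if $\lambda(a)\ge 0$. The field $\mathcal R$ is ordered by $a\succ b$ iff $a\neq b$ and $(a-b)[\lambda(a-b)]>0$; for $z=a+ib\in\mathcal C$ with $a,b\in\mathcal R$ put $|z|=\sqrt{a^2+b^2}\in\mathcal R$, and for $\mathbf x\in\mathcal C^n$ put $\|\mathbf x\|_{\max}=\max_i|\mathbf x^i|\in\mathcal R$. A sequence $(a_k)$ in $\mathcal C$ *converges weakly* to $a\in\mathcal C$, written $a_k\xrightarrow{wk}a$, if for every real $r>0$ there is $N_0$ such that $\sup_{q\le 1/r}|a_k[q]-a[q]|<r$ for all $k>N_0$; weak convergence in $\mathcal C^n$ is meant coordinatewise. Let $n\ge 1$,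 let $A\in\mathcal C^{n\times n}$ be diagonalizable, and suppose that its eigenvalues $\nu_1,\dots,\nu_n$, listed with multiplicity, lie in $\mathcal R$, are at most finite, and satisfy $$1=\nu_1[0]>|\nu_2[0]|\ge\dots\ge|\nu_n[0]|.$$ Let $\mathbf x=\mathbf w_1+\dots+\mathbf w_n\in\mathcal C^n$, where $A\mathbf w_j=\nu_j\mathbf w_j$ for every $j$ (a summand $\mathbf w_j$ with $j\ge 2$ may be zero), all entries of all $\mathbf w_j$ are at most finite, and $\mathbf w_1[0]=(\mathbf w_1^1[0],\dots,\mathbf w_1^n[0])\ne\mathbf 0$. Assume in addition that there is a unique coordinate $i_0$ with $|\mathbf w_1^{i_0}[0]|=\max_i|\mathbf w_1^i[0]|$. Then $$\frac{A^k\mathbf x}{\|A^k\mathbf x\|_{\max}}\xrightarrow{wk}\frac{\mathbf w_1}{\|\mathbf w_1\|_{\max}}\qquad(k\to\infty).$$ -/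

import Mathlib

noncomputable section

/-- A set of rationals is left-finite if it has only finitely many elements below any rational. -/
def IsLeftFinite (S : Set ℚ) : Prop := ∀ r : ℚ, {q ∈ S | q < r}.Finite

namespace IsLeftFinite

theorem mono {S T : Set ℚ} (hT : IsLeftFinite T) (h : S ⊆ T) : IsLeftFinite S :=
  fun r => (hT r).subset fun _ hq => ⟨h hq.1, hq.2⟩

theorem union {S T : Set ℚ} (hS : IsLeftFinite S) (hT : IsLeftFinite T) :
    IsLeftFinite (S ∪ T) := fun r =>
  ((hS r).union (hT r)).subset fun _ hq => hq.1.imp (fun h => ⟨h, hq.2⟩) fun h => ⟨h, hq.2⟩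

theorem singleton (q : ℚ) : IsLeftFinite {q} :=
  fun _ => (Set.finite_singleton q).subset fun _ h => h.1

theorem bddBelow {S : Set ℚ} (hS : IsLeftFinite S) : BddBelow S := by
  rcases S.eq_empty_or_nonempty with rfl | ⟨s, _⟩
  · exact bddBelow_empty
  · obtain ⟨m, hm⟩ := (hS s).bddBelow
    refine ⟨min m s, fun q hq => ?_⟩
    rcases lt_or_ge q s with h | h
    · exact (min_le_left _ _).trans (hm ⟨hq, h⟩)
    · exact (min_le_right _ _).trans h

open scoped Pointwise in
theorem add {S T : Set ℚ} (hS : IsLeftFinite S) (hT : IsLeftFinite T) :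
    IsLeftFinite (S + T) := by
  intro r
  obtain ⟨m, hm⟩ := hS.bddBelow
  obtain ⟨l, hl⟩ := hT.bddBelow
  refine ((hS (r - l)).add (hT (r - m))).subset ?_
  rintro _ ⟨⟨s, hs, t, ht, rfl⟩, hlt⟩
  have h1 := hm hs
  have h2 := hl ht
  simp only at hlt
  exact ⟨s, ⟨hs, by linarith⟩, t, ⟨ht, by linarith⟩, rfl⟩

theorem isPWO {S : Set ℚ} (hS : IsLeftFinite S) : S.IsPWO := by
  rw [Set.isPWO_iff_isWF, Set.isWF_iff_no_descending_seq]
  intro f hf hmem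
  have hinf : (Set.range fun n => f (n + 1)).Infinite :=
    Set.infinite_range_of_injective fun a b h => by simpa using hf.injective h
  refine hinf ((hS (f 0)).subset ?_)
  rintro _ ⟨n, rfl⟩
  exact ⟨hmem _, hf (Nat.succ_pos n)⟩

theorem pow {K : Type*} [Field K] {u : HahnSeries ℚ K} (hu : IsLeftFinite u.support) (n : ℕ) :
    IsLeftFinite (u ^ n).support := by
  induction n with
  | zero => exact (singleton 0).mono (by rw [pow_zero]; exact HahnSeries.support_single_subset)
  | succ n ih =>
    rw [pow_succ]
    exact (ih.add hu).mono HahnSeries.support_mul_subset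

theorem iUnion_pow {K : Type*} [Field K] {u : HahnSeries ℚ K} (hu : IsLeftFinite u.support)
    (hpos : 0 < u.orderTop) : IsLeftFinite (⋃ n : ℕ, (u ^ n).support) := by
  by_cases h0 : u = 0
  · subst h0
    refine (singleton 0).mono (Set.iUnion_subset fun n => ?_)
    rcases n with _ | n
    · rw [pow_zero]; exact HahnSeries.support_single_subset
    · simp
  intro r
  have ho : 0 < u.order := (HahnSeries.zero_lt_orderTop_iff h0).mp hpos
  obtain ⟨N, hN⟩ := exists_nat_gt (r / u.order)
  rw [div_lt_iff₀ ho] at hN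
  refine ((Set.finite_lt_nat N).biUnion fun n _ => hu.pow n r).subset ?_
  rintro q ⟨hq, hqr⟩
  obtain ⟨n, hn⟩ := Set.mem_iUnion.mp hq
  refine Set.mem_iUnion₂.mpr ⟨n, ?_, hn, hqr⟩
  by_contra hnN
  have h1 : (u ^ n).order ≤ q := HahnSeries.order_le_of_coeff_ne_zero hn
  rw [HahnSeries.order_pow, nsmul_eq_mul] at h1
  have h2 : (N : ℚ) ≤ n := by exact_mod_cast not_lt.mp hnN
  nlinarith

theorem heval {K : Type*} [Field K] {u : HahnSeries ℚ K} (hu : IsLeftFinite u.support)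
    (hpos : 0 < u.orderTop) (f : PowerSeries K) : IsLeftFinite (PowerSeries.heval u f).support := by
  refine (hu.iUnion_pow hpos).mono ?_
  rw [PowerSeries.heval_apply]
  refine (HahnSeries.SummableFamily.support_hsum_subset ..).trans (Set.iUnion_mono fun n => ?_)
  rw [HahnSeries.SummableFamily.powerSeriesFamily_of_orderTop_pos hpos]
  intro q hq
  simp only [HahnSeries.mem_support, HahnSeries.coeff_smul, ne_eq, smul_eq_mul, mul_eq_zero,
    not_or] at hq ⊢
  exact hq.2

theorem inv {K : Type*} [Field K] {x : HahnSeries ℚ K} (hx : IsLeftFinite x.support) :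
    IsLeftFinite x⁻¹.support := by
  by_cases h0 : x = 0
  · subst h0; rw [inv_zero]; exact hx
  rw [HahnSeries.inv_def]
  have hs : ∀ (a : ℚ) (c : K), IsLeftFinite (HahnSeries.single a c).support :=
    fun a c => (singleton a).mono HahnSeries.support_single_subset
  refine IsLeftFinite.mono ?_ HahnSeries.support_mul_subset
  refine (hs _ _).add ?_
  set u := 1 - HahnSeries.single (-x.order) (x.leadingCoeff)⁻¹ * x with hu_def
  have hpos : 0 < u.orderTop := HahnSeries.unit_aux x
    (inv_mul_cancel₀ (HahnSeries.leadingCoeff_ne_zero.mpr h0)) _ (neg_add_cancel x.order)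
  have hu : IsLeftFinite u.support := by
    rw [hu_def, sub_eq_add_neg]
    refine IsLeftFinite.mono ?_ (HahnSeries.support_add_subset _ _)
    refine ((singleton 0).mono HahnSeries.support_single_subset).union ?_
    rw [HahnSeries.support_neg]
    exact ((hs _ _).add hx).mono HahnSeries.support_mul_subset
  refine (hu.iUnion_pow hpos).mono ?_
  refine (HahnSeries.SummableFamily.support_hsum_subset ..).trans (Set.iUnion_mono fun n => ?_)
  rw [HahnSeries.SummableFamily.powers_of_orderTop_pos hpos]

end IsLeftFinite

/-- The Levi-Civita field over `K`: the functions `ℚ → K` with left-finite support, with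
componentwise addition and convolution product `(ab)[q] = ∑_{q₁ + q₂ = q} a[q₁] b[q₂]`. It is
realized inside the Hahn series, which are the functions `ℚ → K` with well-ordered support under
the same operations. -/
def leviCivita (K : Type*) [Field K] : Subfield (HahnSeries ℚ K) where
  carrier := {a | IsLeftFinite a.support}
  mul_mem' ha hb := (IsLeftFinite.add ha hb).mono HahnSeries.support_mul_subset
  one_mem' := (IsLeftFinite.singleton 0).mono HahnSeries.support_single_subset
  add_mem' ha hb := (IsLeftFinite.union ha hb).mono (HahnSeries.support_add_subset _ _)
  zero_mem' := (IsLeftFinite.singleton 0).mono (by simp)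
  neg_mem' ha := by
    simp only [Set.mem_ofPred_eq, HahnSeries.support_neg] at *
    exact ha
  inv_mem' _ ha := IsLeftFinite.inv ha

/-- The real Levi-Civita field `𝓡`. -/
abbrev LCReal : Type := leviCivita ℝ

/-- The complex Levi-Civita field `𝓒`. -/
abbrev LCComplex : Type := leviCivita ℂ

namespace LeviCivita

section General

variable {K : Type*} [Field K]

/-- The coefficient `a[q]`. -/
def coeff (a : leviCivita K) (q : ℚ) : K := a.1.coeff q

/-- The element with prescribed coefficients: every function with left-finite support occurs. -/
def ofFun (f : ℚ → K) (hf : IsLeftFinite (Function.support f)) : leviCivita K :=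
  ⟨⟨f, hf.isPWO⟩, hf⟩

theorem coeff_ofFun (f : ℚ → K) (hf : IsLeftFinite (Function.support f)) (q : ℚ) :
    coeff (ofFun f hf) q = f q := rfl

theorem isLeftFinite_support (a : leviCivita K) : IsLeftFinite (Function.support (coeff a)) := a.2

theorem ext {a b : leviCivita K} (h : ∀ q, coeff a q = coeff b q) : a = b :=
  Subtype.ext (HahnSeries.ext (funext h))

/-- Apply an additive map to all coefficients. -/
def mapCoeff {L : Type*} [Field L] (f : K →+ L) (a : leviCivita K) : leviCivita L :=
  ofFun (fun q => f (coeff a q))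
    ((isLeftFinite_support a).mono (Function.support_comp_subset (map_zero f) _))

/-- `a` is at most finite: `λ(a) ≥ 0`, where `λ(a)` is the least element of the support of `a`
(and `λ(0) = ∞`). -/
def AtMostFinite (a : leviCivita K) : Prop := 0 ≤ a.1.orderTop

end General

section Weak

variable {K : Type*} [NormedField K]

/-- The semi-norm `‖a‖_r = sup_{q ≤ r} |a[q]|`. -/
def seminorm (r : ℝ) (a : leviCivita K) : ℝ := ⨆ q : {q : ℚ // (q : ℝ) ≤ r}, ‖coeff a q‖

/-- The supremum defining `‖a‖_r` is over a bounded family. -/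
theorem bddAbove_seminorm (r : ℝ) (a : leviCivita K) :
    BddAbove (Set.range fun q : {q : ℚ // (q : ℝ) ≤ r} => ‖coeff a q‖) := by
  obtain ⟨s, hs⟩ := exists_rat_gt r
  have hfin := ((isLeftFinite_support a s).image fun q => ‖coeff a q‖).union
    (Set.finite_singleton 0)
  refine hfin.bddAbove.mono ?_
  rintro _ ⟨⟨q, hq⟩, rfl⟩
  by_cases h : coeff a q = 0
  · right; simp [h]
  · left; exact ⟨q, ⟨h, by exact_mod_cast hq.trans_lt hs⟩, rfl⟩

/-- Weak convergence of a sequence to `a`. -/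
def WeakLimit (u : ℕ → leviCivita K) (a : leviCivita K) : Prop :=
  ∀ r : ℝ, 0 < r → ∃ N : ℕ, ∀ n, N < n → seminorm (1 / r) (u n - a) < r

end Weak

section Order

/-- The order of `𝓡`: `a < b` iff `(b - a)[λ(b - a)] > 0`; see `lt_iff`. -/
instance : LinearOrder LCReal :=
  LinearOrder.lift' (fun a => toLex a.1) fun _ _ h => Subtype.ext (toLex.injective h)

theorem toLex_lt {a b : LCReal} : a < b ↔ toLex a.1 < toLex b.1 := Iff.rfl

instance : IsStrictOrderedRing LCReal :=
  Function.Injective.isStrictOrderedRing (fun a : LCReal => toLex a.1) rfl rfl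
    (fun _ _ => rfl) (fun _ _ => rfl) Iff.rfl Iff.rfl

theorem lt_iff {a b : LCReal} : a < b ↔ 0 < (b - a).1.leadingCoeff := by
  rw [← sub_pos, toLex_lt]
  exact (HahnSeries.leadingCoeff_pos_iff (x := toLex (b - a).1)).symm

theorem exists_sqrt {a : LCReal} (ha : 0 ≤ a) : ∃ b : LCReal, 0 ≤ b ∧ b * b = a := by
  suffices h : ∃ b : LCReal, b * b = a by
    obtain ⟨b, hb⟩ := h
    exact ⟨|b|, abs_nonneg b, by rw [abs_mul_abs_self, hb]⟩
  rcases ha.eq_or_lt with rfl | hpos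
  · exact ⟨0, mul_zero 0⟩
  have hc : 0 < a.1.leadingCoeff := by simpa using lt_iff.mp hpos
  have h0 : a.1 ≠ 0 := HahnSeries.leadingCoeff_ne_zero.mp hc.ne'
  set c := a.1.leadingCoeff
  set o := a.1.order
  have hs : ∀ (q : ℚ) (t : ℝ), HahnSeries.single q t ∈ leviCivita ℝ :=
    fun q t => (IsLeftFinite.singleton q).mono HahnSeries.support_single_subset
  set u : HahnSeries ℚ ℝ := HahnSeries.single (-o) c⁻¹ * a.1 - 1 with hu
  have hmem : u ∈ leviCivita ℝ := sub_mem (mul_mem (hs _ _) a.2) (one_mem _)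
  have hupos : 0 < u.orderTop := by
    have := HahnSeries.unit_aux a.1 (inv_mul_cancel₀ hc.ne') _ (neg_add_cancel o)
    rwa [← HahnSeries.orderTop_neg, neg_sub] at this
  set f : PowerSeries ℝ := PowerSeries.binomialSeries ℝ (1 / 2 : ℚ)
  have hf : f * f = 1 + PowerSeries.X := by
    rw [← PowerSeries.binomialSeries_add]
    have := PowerSeries.binomialSeries_nat (R := ℚ) (A := ℝ) 1
    rw [pow_one, Nat.cast_one] at this
    rw [← this]; norm_num
  have hsq : PowerSeries.heval u f * PowerSeries.heval u f = 1 + u := by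
    rw [← PowerSeries.heval_mul, hf, map_add, map_one, PowerSeries.heval_X _ hupos]
  refine ⟨⟨HahnSeries.single (o / 2) (Real.sqrt c), hs _ _⟩ *
    ⟨PowerSeries.heval u f, IsLeftFinite.heval hmem hupos f⟩, Subtype.ext ?_⟩
  change HahnSeries.single (o / 2) (Real.sqrt c) * PowerSeries.heval u f *
    (HahnSeries.single (o / 2) (Real.sqrt c) * PowerSeries.heval u f) = a.1
  rw [mul_mul_mul_comm, hsq, HahnSeries.single_mul_single, add_halves,
    Real.mul_self_sqrt hc.le, hu, add_sub_cancel, ← mul_assoc, HahnSeries.single_mul_single,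
    add_neg_cancel, mul_inv_cancel₀ hc.ne', HahnSeries.single_zero_one, one_mul]

/-- The nonnegative square root of a nonnegative element of `𝓡` (and `0` on negative elements). -/
def sqrt (a : LCReal) : LCReal := open Classical in if h : 0 ≤ a then (exists_sqrt h).choose else 0

theorem sqrt_nonneg (a : LCReal) : 0 ≤ sqrt a := by
  unfold sqrt
  split_ifs with h
  · exact (exists_sqrt h).choose_spec.1
  · exact le_rfl

theorem sqrt_mul_self {a : LCReal} (ha : 0 ≤ a) : sqrt a * sqrt a = a := by
  unfold sqrt
  rw [dif_pos ha]
  exact (exists_sqrt ha).choose_spec.2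

end Order

section Complex

/-- The embedding of `𝓡` into `𝓒`. -/
def ofReal (a : LCReal) : LCComplex := mapCoeff Complex.ofRealHom.toAddMonoidHom a

/-- The part `a` in the unique representation `z = a + i b` with `a, b ∈ 𝓡`. -/
def re (z : LCComplex) : LCReal := mapCoeff Complex.reAddGroupHom z

/-- The part `b` in the unique representation `z = a + i b` with `a, b ∈ 𝓡`. -/
def im (z : LCComplex) : LCReal := mapCoeff Complex.imAddGroupHom z

/-- The absolute value `|z| = √(a² + b²)` of `z = a + i b`, an element of `𝓡`. -/
def absC (z : LCComplex) : LCReal := sqrt (re z ^ 2 + im z ^ 2)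

/-- The maximum norm `max_i |x_i|` of a vector over `𝓒`, an element of `𝓡`. -/
def maxNorm {ι : Type*} [Fintype ι] [Nonempty ι] (x : ι → LCComplex) : LCReal :=
  Finset.univ.sup' Finset.univ_nonempty fun i => absC (x i)

end Complex

/-- A square matrix over a field is diagonalizable if it is similar to a diagonal matrix. -/
def IsDiagonalizable {ι F : Type*} [Fintype ι] [DecidableEq ι] [Field F] (A : Matrix ι ι F) :
    Prop :=
  ∃ (P : Matrix ι ι F) (D : ι → F), IsUnit P ∧ A = P * Matrix.diagonal D * P⁻¹

end LeviCivita

end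

/-! Dividing by the positive scalar `ν 0 ^ k`, which cancels in the normalized vector, replaces `A ^
k x` by `y k = ∑ j, μ j ^ k w j` with `μ j = ν j / ν 0`. Here `μ 0 = 1`, and the zeroth coefficient
of every other `μ j` has absolute value below one.

All the data have supports in one left-finite monoid `M` of nonnegative exponents
(`exists_supported`). Products stay supported in `M`, and so do quotients by, and square roots with,
a nonzero zeroth coefficient. With supports in `M`, convergence of each coefficient gives weak
convergence (`CoeffTendsto.weakLimit`), and each coefficient of a product, quotient or root is a
finite expression in the data and in lower coefficients. Limits therefore follow by well-founded
induction on the exponent. The same induction bounds the coefficient of `a ^ k` at `q` by `C_q ρ ^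
k` with one `ρ < 1` (`CoeffTendsto.pow`), so `y k` tends to `w 0`.

The maximum is harmless because a unique coordinate `i₀` dominates in the zeroth coefficients of `w
0`: eventually the norm of `y k` is the modulus of its coordinate `i₀`, and modulus and division are
continuous there (`weakLimit_div_maxNorm`). -/

noncomputable section

open Filter Topology

/-! ### Left-finite sets of exponents -/

namespace IsLeftFinite

open scoped Pointwise in
theorem nsmul {S : Set ℚ} (hS : IsLeftFinite S) (n : ℕ) : IsLeftFinite (n • S) := by
  induction n with
  | zero => rw [zero_nsmul]; exact singleton 0
  | succ n ih => rw [succ_nsmul]; exact ih.add hS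

/-- Only finitely many elements lie between 0 and 1. The gap above 0 limits how many positive
generators can add up to a bounded sum. -/
theorem exists_pos_le {S : Set ℚ} (hS : IsLeftFinite S) :
    ∃ δ : ℚ, 0 < δ ∧ ∀ q ∈ S, 0 < q → δ ≤ q := by
  have hfin : {q ∈ S | 0 < q ∧ q < 1}.Finite :=
    (hS 1).subset fun q hq => ⟨hq.1, hq.2.2⟩
  rcases Set.eq_empty_or_nonempty {q ∈ S | 0 < q ∧ q < 1} with h | h
  · refine ⟨1, one_pos, fun q hq h0 => ?_⟩
    by_contra hlt
    exact (Set.eq_empty_iff_forall_notMem.mp h q) ⟨hq, h0, not_le.mp hlt⟩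
  · obtain ⟨d, hd, hmin⟩ := hfin.exists_minimalFor id _ h
    refine ⟨d, hd.2.1, fun q hq h0 => ?_⟩
    rcases lt_or_ge q 1 with h1 | h1
    · by_contra hlt
      exact hlt (hmin ⟨hq, h0, h1⟩ (not_le.mp hlt).le)
    · exact hd.2.2.le.trans h1

open scoped Pointwise in
/-- The monoid generated by a left-finite set of nonnegative rationals is left-finite. -/
theorem addSubmonoid_closure {S : Set ℚ} (hS : IsLeftFinite S) (h0 : ∀ q ∈ S, 0 ≤ q) :
    IsLeftFinite (AddSubmonoid.closure S : Set ℚ) := by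
  obtain ⟨δ, hδ, hmin⟩ := hS.exists_pos_le
  -- Here `n` counts only the positive summands; a zero generator is treated as the empty sum.
  -- Elements below `r` then need fewer than `N` summands.
  have key : ∀ q ∈ AddSubmonoid.closure S, ∃ n : ℕ, q ∈ n • S ∧ n * δ ≤ q := by
    intro q hq
    induction hq using AddSubmonoid.closure_induction with
    | mem q hq =>
      rcases (h0 q hq).eq_or_lt with rfl | hpos
      · exact ⟨0, by simp, by simp⟩
      · exact ⟨1, by simpa using hq, by simpa using hmin q hq hpos⟩
    | zero => exact ⟨0, by simp, by simp⟩
    | add a b _ _ ha hb =>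
      obtain ⟨m, hm, hm'⟩ := ha
      obtain ⟨l, hl, hl'⟩ := hb
      refine ⟨m + l, ?_, ?_⟩
      · rw [add_nsmul]; exact Set.add_mem_add hm hl
      · push_cast; linarith
  intro r
  obtain ⟨N, hN⟩ := exists_nat_gt (r / δ)
  rw [div_lt_iff₀ hδ] at hN
  refine ((Set.finite_lt_nat N).biUnion fun n _ => hS.nsmul n r).subset ?_
  rintro q ⟨hq, hqr⟩
  obtain ⟨n, hn, hle⟩ := key q hq
  refine Set.mem_iUnion₂.mpr ⟨n, ?_, hn, hqr⟩
  by_contra hnN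
  have h2 : (N : ℚ) ≤ n := by exact_mod_cast not_lt.mp hnN
  nlinarith

theorem iUnion {ι : Type*} [Finite ι] {S : ι → Set ℚ} (hS : ∀ i, IsLeftFinite (S i)) :
    IsLeftFinite (⋃ i, S i) := fun r =>
  (Set.finite_iUnion fun i => hS i r).subset fun q hq => by
    obtain ⟨i, hi⟩ := Set.mem_iUnion.mp hq.1
    exact Set.mem_iUnion.mpr ⟨i, hi, hq.2⟩

end IsLeftFinite

namespace LeviCivita

theorem forall_mem_of_isWF {s : Set ℚ} (hs : s.IsWF) {P : ℚ → Prop}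
    (h : ∀ q ∈ s, (∀ p ∈ s, p < q → P p) → P q) : ∀ q ∈ s, P q :=
  fun _ hq => Set.WellFoundedOn.induction hs hq h

/-! ### Coefficients of products; supports in a monoid of exponents -/

section Algebra

variable {K : Type*} [Field K]

theorem coeff_zero (q : ℚ) : coeff (0 : leviCivita K) q = 0 := rfl

theorem coeff_add (a b : leviCivita K) (q : ℚ) : coeff (a + b) q = coeff a q + coeff b q := rfl

theorem coeff_sub (a b : leviCivita K) (q : ℚ) : coeff (a - b) q = coeff a q - coeff b q := rfl

theorem coeff_sum {ι : Type*} (s : Finset ι) (f : ι → leviCivita K) (q : ℚ) :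
    coeff (∑ i ∈ s, f i) q = ∑ i ∈ s, coeff (f i) q :=
  map_sum (⟨⟨fun a => coeff a q, coeff_zero q⟩, fun a b => coeff_add a b q⟩ : leviCivita K →+ K) f s

/-- The index set depends on `S` and `T` only, so a whole sequence of products can share it. -/
theorem coeff_mul {a b : leviCivita K} {S T : Set ℚ} (hS : S.IsPWO) (hT : T.IsPWO)
    (ha : ∀ q ∉ S, coeff a q = 0) (hb : ∀ q ∉ T, coeff b q = 0) (q : ℚ) :
    coeff (a * b) q = ∑ ij ∈ Finset.antidiagonal hS hT q, coeff a ij.1 * coeff b ij.2 := by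
  have ha' : a.1.support ⊆ S := fun p hp => by by_contra h; exact hp (ha p h)
  have hb' : b.1.support ⊆ T := fun p hp => by by_contra h; exact hp (hb p h)
  change (a.1 * b.1).coeff q = _
  rw [HahnSeries.coeff_mul_left' hS ha']
  refine Finset.sum_subset (Finset.antidiagonal_mono_right hb') fun ij h1 h2 => ?_
  have : b.1.coeff ij.2 = 0 := by
    by_contra h
    simp only [Finset.mem_antidiagonal] at h1 h2
    exact h2 ⟨h1.1, h, h1.2.2⟩
  change a.1.coeff ij.1 * b.1.coeff ij.2 = 0
  rw [this, mul_zero]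

/-- The coefficient of a product, with the term of index `(0, q)` singled out. -/
theorem coeff_mul_eq_add {a b : leviCivita K} {S T : Set ℚ} (hS : S.IsPWO) (hT : T.IsPWO)
    (ha : ∀ q ∉ S, coeff a q = 0) (hb : ∀ q ∉ T, coeff b q = 0) {q : ℚ} (h0 : 0 ∈ S)
    (hq : q ∈ T) :
    coeff (a * b) q = coeff a 0 * coeff b q +
      ∑ ij ∈ (Finset.antidiagonal hS hT q).erase (0, q), coeff a ij.1 * coeff b ij.2 := by
  rw [coeff_mul hS hT ha hb]
  exact (Finset.add_sum_erase (Finset.antidiagonal hS hT q)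
    (fun ij => coeff a ij.1 * coeff b ij.2) (a := (0, q)) (by simp [h0, hq])).symm

/-- Only the erased pair has first entry 0. This is what makes the recursions on coefficients
well-founded. -/
theorem snd_lt_of_mem_erase {S T : Set ℚ} {hS : S.IsPWO} {hT : T.IsPWO} (h0 : ∀ q ∈ S, 0 ≤ q)
    {q : ℚ} {ij : ℚ × ℚ} (h : ij ∈ (Finset.antidiagonal hS hT q).erase (0, q)) :
    ij.1 ∈ S ∧ ij.2 ∈ T ∧ ij.1 + ij.2 = q ∧ 0 < ij.1 ∧ ij.2 < q := by
  simp only [Finset.mem_erase, Finset.mem_antidiagonal] at h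
  obtain ⟨hne, h1, h2, h3⟩ := h
  have hpos : 0 < ij.1 := (h0 _ h1).lt_of_ne fun h => hne <| Prod.ext h.symm <| by
    simpa [← h] using h3
  exact ⟨h1, h2, h3, hpos, by linarith⟩

/-- The elements whose support lies in a given monoid of exponents. -/
def supported (K : Type*) [Field K] (M : AddSubmonoid ℚ) : Subring (leviCivita K) where
  carrier := {a | ∀ q ∉ M, coeff a q = 0}
  mul_mem' {a b} ha hb q hq := by
    by_contra h
    obtain ⟨s, hs, t, ht, rfl⟩ := HahnSeries.support_mul_subset (x := a.1) (y := b.1) h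
    refine hq (M.add_mem ?_ ?_)
    · by_contra h'; exact hs (ha s h')
    · by_contra h'; exact ht (hb t h')
  one_mem' q hq := HahnSeries.coeff_single_of_ne fun h => hq (h ▸ M.zero_mem)
  add_mem' ha hb q hq := by rw [coeff_add, ha q hq, hb q hq, add_zero]
  zero_mem' _ _ := rfl
  neg_mem' {a} ha q hq := by
    change -coeff a q = 0
    rw [ha q hq, neg_zero]

theorem atMostFinite_iff {a : leviCivita K} : AtMostFinite a ↔ ∀ q < 0, coeff a q = 0 := by
  refine ⟨fun h q hq => HahnSeries.coeff_eq_zero_of_lt_orderTop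
    ((WithTop.coe_lt_coe.mpr hq).trans_le h), fun h => ?_⟩
  by_contra hlt
  unfold AtMostFinite at hlt
  by_cases h0 : a.1 = 0
  · simp [h0] at hlt
  rw [← HahnSeries.order_eq_orderTop_of_ne_zero h0, not_le] at hlt
  exact HahnSeries.coeff_order_eq_zero.not.mpr h0 (h _ (WithTop.coe_lt_coe.mp hlt))

theorem AtMostFinite.of_mul_self {a : leviCivita K} (h : AtMostFinite (a * a)) :
    AtMostFinite a := by
  unfold AtMostFinite at h ⊢
  change 0 ≤ (a.1 * a.1).orderTop at h
  rw [HahnSeries.orderTop_mul] at h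
  by_contra hlt
  by_cases h0 : a.1 = 0
  · simp [h0] at hlt
  rw [← HahnSeries.order_eq_orderTop_of_ne_zero h0] at h hlt
  have h1 : a.1.order < 0 := WithTop.coe_lt_coe.mp (not_le.mp hlt)
  have h2 : 0 ≤ a.1.order + a.1.order := WithTop.coe_le_coe.mp h
  linarith

variable {M : AddSubmonoid ℚ}

theorem AtMostFinite.of_mem_supported (h0 : ∀ q ∈ M, 0 ≤ q) {a : leviCivita K}
    (ha : a ∈ supported K M) : AtMostFinite a :=
  atMostFinite_iff.mpr fun q hq => ha q fun h => (h0 q h).not_gt hq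

/-- Two nonnegative exponents with sum 0 both vanish. The case split is there because
`coeff_mul_eq_add` needs 0 in both supports. -/
theorem coeff_mul_zero {a b : leviCivita K} (ha : AtMostFinite a) (hb : AtMostFinite b) :
    coeff (a * b) 0 = coeff a 0 * coeff b 0 := by
  by_cases hab : coeff b 0 = 0 ∨ coeff a 0 = 0
  · have : coeff (a * b) 0 = 0 := by
      by_contra h
      obtain ⟨s, hs, t, ht, hst⟩ := HahnSeries.support_mul_subset (x := a.1) (y := b.1) h
      have hs0 : 0 ≤ s := by by_contra h'; exact hs (atMostFinite_iff.mp ha s (not_le.mp h'))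
      have ht0 : 0 ≤ t := by by_contra h'; exact ht (atMostFinite_iff.mp hb t (not_le.mp h'))
      simp only at hst
      obtain rfl : s = 0 := by linarith
      obtain rfl : t = 0 := by linarith
      exact hab.elim ht hs
    rw [this]
    rcases hab with h | h <;> simp [h]
  push Not at hab
  rw [coeff_mul_eq_add a.1.isPWO_support b.1.isPWO_support (fun q hq => not_not.mp hq)
    (fun q hq => not_not.mp hq) hab.2 hab.1, add_eq_left]
  refine Finset.sum_eq_zero fun ij hij => ?_
  obtain ⟨-, -, -, -, h⟩ := snd_lt_of_mem_erase (fun q hq => by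
    by_contra h'; exact hq (atMostFinite_iff.mp ha q (not_le.mp h'))) hij
  rw [atMostFinite_iff.mp hb _ h, mul_zero]

/-- Division by an element with nonzero zeroth coefficient does not enlarge the support. -/
theorem mem_supported_of_mul (hM : IsLeftFinite (M : Set ℚ)) (h0 : ∀ q ∈ M, 0 ≤ q)
    {a b : leviCivita K} (ha : a ∈ supported K M) (hab : a * b ∈ supported K M)
    (ha0 : coeff a 0 ≠ 0) : b ∈ supported K M := by
  suffices h : ∀ q ∈ b.1.support, q ∉ M → coeff b q = 0 from fun q hq => by
    by_contra hne; exact hne (h q hne hq)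
  -- For `q ∉ M`, a pair with first entry in `M` has second entry outside `M`, so by induction only
  -- `a[0] b[q]` survives, and it must be 0.
  refine forall_mem_of_isWF b.1.isWF_support fun q hq ih hqM => ?_
  have h := coeff_mul_eq_add hM.isPWO b.1.isPWO_support ha (fun q hq => not_not.mp hq)
    M.zero_mem hq
  rw [hab q hqM, Finset.sum_eq_zero, add_zero] at h
  · exact (mul_eq_zero.mp h.symm).resolve_left ha0
  · intro ij hij
    obtain ⟨h1, h2, h3, -, h5⟩ := snd_lt_of_mem_erase h0 hij
    rw [ih _ h2 h5 fun h => hqM (h3 ▸ M.add_mem h1 h), mul_zero]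

/-- Square roots of elements with nonzero zeroth coefficient do not enlarge the support. -/
theorem mem_supported_of_mul_self [NeZero (2 : K)] (h0 : ∀ q ∈ M, 0 ≤ q)
    {a : leviCivita K} (ha : a * a ∈ supported K M) (ha0 : coeff a 0 ≠ 0) :
    a ∈ supported K M := by
  have hfin : AtMostFinite a := .of_mul_self (.of_mem_supported h0 ha)
  have hs : ∀ q ∈ a.1.support, 0 ≤ q := fun q hq => by
    by_contra h'; exact hq (atMostFinite_iff.mp hfin q (not_le.mp h'))
  suffices h : ∀ q ∈ a.1.support, q ∉ M → coeff a q = 0 from fun q hq => by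
    by_contra hne; exact hne (h q hne hq)
  refine forall_mem_of_isWF a.1.isWF_support fun q hq ih hqM => ?_
  have hq0 : q ≠ 0 := fun h => hqM (h ▸ M.zero_mem)
  have h := coeff_mul_eq_add a.1.isPWO_support a.1.isPWO_support (fun q hq => not_not.mp hq)
    (fun q hq => not_not.mp hq) ha0 hq
  -- The pairs `(0, q)` and `(q, 0)` contribute `2 a[0] a[q]`. Every other pair has both entries
  -- below `q` and at least one outside `M`.
  rw [ha q hqM, Finset.sum_eq_single (q, 0)] at h
  · have h2 : (2 * coeff a 0) * coeff a q = 0 := by rw [h]; ring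
    exact (mul_eq_zero.mp h2).resolve_left (mul_ne_zero two_ne_zero ha0)
  · intro ij hij hne
    obtain ⟨h1, h2, h3, -, h5⟩ := snd_lt_of_mem_erase hs hij
    have h6 : ij.2 ≠ 0 := fun h => hne (Prod.ext (by simpa [h] using h3) h)
    have h7 : ij.1 < q := by have := (hs _ h2).lt_of_ne' h6; linarith
    by_cases hM1 : ij.1 ∈ M
    · rw [ih _ h2 h5 fun h => hqM (h3 ▸ M.add_mem hM1 h), mul_zero]
    · rw [ih _ h1 h7 hM1, zero_mul]
  · intro hn
    refine absurd ?_ hn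
    simp only [Finset.mem_erase, Finset.mem_antidiagonal, add_zero, and_true]
    exact ⟨fun h => hq0 (Prod.ext_iff.mp h).1, hq, ha0⟩

end Algebra

/-! ### Coefficientwise and weak convergence -/

section Convergence

variable {K : Type*} [NormedField K] {M : AddSubmonoid ℚ}

/-- Convergence of every coefficient. -/
def CoeffTendsto (u : ℕ → leviCivita K) (a : leviCivita K) : Prop :=
  ∀ q, Tendsto (fun k => coeff (u k) q) atTop (𝓝 (coeff a q))

/-- For sequences with supports in a common left-finite set, convergence of the coefficients
implies weak convergence. -/
theorem CoeffTendsto.weakLimit (hM : IsLeftFinite (M : Set ℚ)) {u : ℕ → leviCivita K}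
    {a : leviCivita K} (h : CoeffTendsto u a) (hu : ∀ᶠ k in atTop, u k ∈ supported K M)
    (ha : a ∈ supported K M) : WeakLimit u a := by
  intro r hr
  obtain ⟨s, hs⟩ := exists_rat_gt (1 / r)
  -- Only finitely many exponents matter. The bound `r / 2` keeps the supremum strictly below `r`.
  have hev : ∀ᶠ k in atTop, ∀ q ∈ {q ∈ (M : Set ℚ) | q < s}, ‖coeff (u k - a) q‖ < r / 2 := by
    rw [(hM s).eventually_all]
    intro q _
    have := ((h q).sub_const (coeff a q)).norm
    rw [sub_self, norm_zero] at this
    exact this.eventually_lt_const (half_pos hr)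
  obtain ⟨N, hN⟩ := eventually_atTop.mp (hev.and hu)
  refine ⟨N, fun n hn => (Real.iSup_le (fun q => ?_) (half_pos hr).le).trans_lt (half_lt_self hr)⟩
  obtain ⟨h1, h2⟩ := hN n hn.le
  by_cases hq : q.1 ∈ M
  · exact (h1 q ⟨hq, by exact_mod_cast q.2.trans_lt hs⟩).le
  · rw [sub_mem h2 ha q hq, norm_zero]
    exact (half_pos hr).le

theorem CoeffTendsto.const (a : leviCivita K) : CoeffTendsto (fun _ => a) a :=
  fun _ => tendsto_const_nhds

theorem CoeffTendsto.sum {ι : Type*} {s : Finset ι} {u : ι → ℕ → leviCivita K}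
    {a : ι → leviCivita K} (h : ∀ i ∈ s, CoeffTendsto (u i) (a i)) :
    CoeffTendsto (fun k => ∑ i ∈ s, u i k) (∑ i ∈ s, a i) := fun q => by
  simp only [coeff_sum]
  exact tendsto_finsetSum _ fun i hi => h i hi q

theorem CoeffTendsto.add {u v : ℕ → leviCivita K} {a b : leviCivita K} (hu : CoeffTendsto u a)
    (hv : CoeffTendsto v b) : CoeffTendsto (fun k => u k + v k) (a + b) :=
  fun q => (hu q).add (hv q)

theorem CoeffTendsto.mul (hM : IsLeftFinite (M : Set ℚ)) {u v : ℕ → leviCivita K}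
    {a b : leviCivita K} (h : CoeffTendsto u a) (h' : CoeffTendsto v b)
    (hu : ∀ k, u k ∈ supported K M) (hv : ∀ k, v k ∈ supported K M)
    (ha : a ∈ supported K M) (hb : b ∈ supported K M) :
    CoeffTendsto (fun k => u k * v k) (a * b) := fun q => by
  simp only [fun k => coeff_mul hM.isPWO hM.isPWO (hu k) (hv k) q,
    coeff_mul hM.isPWO hM.isPWO ha hb q]
  exact tendsto_finsetSum _ fun ij _ => (h _).mul (h' _)

/-- Continuity of division: the product formula is solved for `v[q]` in terms of `u`, `u v` and
lower coefficients of `v`. Support conditions on `u` and `v` are only eventual, since quotients and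
moduli are controlled only once a zeroth coefficient is nonzero. -/
theorem CoeffTendsto.of_mul (hM : IsLeftFinite (M : Set ℚ)) (h0 : ∀ q ∈ M, 0 ≤ q)
    {u v : ℕ → leviCivita K} {a b : leviCivita K} (h : CoeffTendsto u a)
    (h' : CoeffTendsto (fun k => u k * v k) (a * b))
    (hu : ∀ᶠ k in atTop, u k ∈ supported K M) (hv : ∀ᶠ k in atTop, v k ∈ supported K M)
    (ha : a ∈ supported K M) (hb : b ∈ supported K M) (ha0 : coeff a 0 ≠ 0) :
    CoeffTendsto v b := by
  have hzero : ∀ q ∉ M, Tendsto (fun k => coeff (v k) q) atTop (𝓝 (coeff b q)) := fun q hq => by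
    rw [hb q hq]
    exact tendsto_const_nhds.congr' (hv.mono fun k hk => (hk q hq).symm)
  suffices hmem : ∀ q ∈ (M : Set ℚ), Tendsto (fun k => coeff (v k) q) atTop (𝓝 (coeff b q)) from
    fun q => (em (q ∈ M)).elim (hmem q) (hzero q)
  refine forall_mem_of_isWF hM.isPWO.isWF fun q hq ih => ?_
  have hsum : Tendsto (fun k => (coeff (u k * v k) q -
      ∑ ij ∈ (Finset.antidiagonal hM.isPWO hM.isPWO q).erase (0, q),
        coeff (u k) ij.1 * coeff (v k) ij.2) / coeff (u k) 0) atTop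
      (𝓝 ((coeff (a * b) q - ∑ ij ∈ (Finset.antidiagonal hM.isPWO hM.isPWO q).erase (0, q),
        coeff a ij.1 * coeff b ij.2) / coeff a 0)) := by
    refine ((h' q).sub (tendsto_finsetSum _ fun ij hij => ?_)).div (h 0) ha0
    obtain ⟨-, h2, -, -, h5⟩ := snd_lt_of_mem_erase h0 hij
    exact (h _).mul (ih _ h2 h5)
  rw [coeff_mul_eq_add hM.isPWO hM.isPWO ha hb M.zero_mem hq, add_sub_cancel_right,
    mul_div_cancel_left₀ _ ha0] at hsum
  refine hsum.congr' ?_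
  filter_upwards [hu, hv, (h 0).eventually_ne ha0] with k h1 h2 h3
  rw [coeff_mul_eq_add hM.isPWO hM.isPWO h1 h2 M.zero_mem hq, add_sub_cancel_right,
    mul_div_cancel_left₀ _ h3]

/-- Powers of an at most finite element whose zeroth coefficient has norm less than one. -/
theorem CoeffTendsto.pow (hM : IsLeftFinite (M : Set ℚ)) (h0 : ∀ q ∈ M, 0 ≤ q)
    {a : leviCivita K} (ha : a ∈ supported K M) (hlt : ‖coeff a 0‖ < 1) :
    CoeffTendsto (fun k => a ^ k) 0 := by
  obtain ⟨ρ, hρ, hρ1⟩ := exists_between hlt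
  have hρ0 : 0 < ρ := (norm_nonneg _).trans_lt hρ
  have key : ∀ q ∈ M, ∃ C, ∀ k : ℕ, ‖coeff (a ^ k) q‖ ≤ C * ρ ^ k := by
    refine forall_mem_of_isWF (s := (M : Set ℚ)) hM.isPWO.isWF fun q hq ih => ?_
    -- Made total in `p`, with the dummy constant 0, so that `choose` yields a function.
    have ih' : ∀ p, ∃ C, p ∈ M → p < q → ∀ k : ℕ, ‖coeff (a ^ k) p‖ ≤ C * ρ ^ k := fun p => by
      by_cases hp : p ∈ M ∧ p < q
      · obtain ⟨C, hC⟩ := ih p hp.1 hp.2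
        exact ⟨C, fun _ _ => hC⟩
      · exact ⟨0, fun h1 h2 => absurd ⟨h1, h2⟩ hp⟩
    choose C hC using ih'
    set D := ∑ ij ∈ (Finset.antidiagonal hM.isPWO hM.isPWO q).erase (0, q),
      ‖coeff a ij.1‖ * C ij.2
    have hstep : ∀ k : ℕ, ‖coeff (a ^ (k + 1)) q‖ ≤
        ‖coeff a 0‖ * ‖coeff (a ^ k) q‖ + D * ρ ^ k := by
      intro k
      rw [pow_succ', coeff_mul_eq_add hM.isPWO hM.isPWO ha (pow_mem ha k) M.zero_mem hq,
        ← norm_mul, Finset.sum_mul]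
      refine (norm_add_le _ _).trans (add_le_add_right (norm_sum_le_of_le _ fun ij hij => ?_) _)
      obtain ⟨-, h2, -, -, h5⟩ := snd_lt_of_mem_erase h0 hij
      rw [norm_mul, mul_assoc]
      exact mul_le_mul_of_nonneg_left (hC _ h2 h5 k) (norm_nonneg _)
    -- The first entry covers `k = 0`; the second gives `‖a[0]‖ E + D ≤ ρ E`, which closes the
    -- induction on `k`.
    set E := max ‖coeff (a ^ 0) q‖ (D / (ρ - ‖coeff a 0‖))
    refine ⟨E, fun k => ?_⟩
    induction k with
    | zero => rw [pow_zero ρ, mul_one]; exact le_max_left _ _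
    | succ k ihk =>
      have hD : D ≤ E * (ρ - ‖coeff a 0‖) :=
        (div_le_iff₀ (sub_pos.mpr hρ)).mp (le_max_right _ _)
      have hk : 0 < ρ ^ k := pow_pos hρ0 k
      calc ‖coeff (a ^ (k + 1)) q‖ ≤ ‖coeff a 0‖ * ‖coeff (a ^ k) q‖ + D * ρ ^ k := hstep k
        _ ≤ ‖coeff a 0‖ * (E * ρ ^ k) + E * (ρ - ‖coeff a 0‖) * ρ ^ k := by gcongr
        _ = E * ρ ^ (k + 1) := by ring
  intro q
  rw [coeff_zero]
  by_cases hq : q ∈ M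
  · obtain ⟨C, hC⟩ := key q hq
    refine squeeze_zero_norm hC ?_
    simpa using (tendsto_pow_atTop_nhds_zero_of_lt_one hρ0.le hρ1).const_mul C
  · simp only [fun k => pow_mem ha k q hq, tendsto_const_nhds]

end Convergence

end LeviCivita

/-! ### Signs and square roots in 𝓡 -/

namespace LeviCivita

variable {M : AddSubmonoid ℚ}

/-- The hypotheses force `λ(a) = 0`, so the zeroth coefficient is the leading one. -/
theorem pos_of_coeff_zero_pos {a : LCReal} (ha : AtMostFinite a) (h : 0 < coeff a 0) : 0 < a := by
  rw [lt_iff, sub_zero]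
  have h0 : a.1 ≠ 0 := fun h' => by
    have : a = 0 := Subtype.ext h'
    rw [this, coeff_zero] at h
    exact h.false
  have hle : a.1.order ≤ 0 := HahnSeries.order_le_of_coeff_ne_zero h.ne'
  have hge : 0 ≤ a.1.order := by
    unfold AtMostFinite at ha
    rw [← HahnSeries.order_eq_orderTop_of_ne_zero h0] at ha
    exact WithTop.coe_le_coe.mp ha
  rwa [HahnSeries.leadingCoeff_eq, le_antisymm hle hge]

theorem coeff_zero_nonneg {a : LCReal} (ha : AtMostFinite a) (h : 0 ≤ a) : 0 ≤ coeff a 0 := by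
  by_contra hlt
  have hneg : AtMostFinite (-a) := atMostFinite_iff.mpr fun q hq => by
    change -coeff a q = 0
    rw [atMostFinite_iff.mp ha q hq, neg_zero]
  have := pos_of_coeff_zero_pos hneg (by change 0 < -coeff a 0; linarith)
  linarith

/-- Continuity of the square root for coefficientwise convergence. -/
theorem CoeffTendsto.of_mul_self (hM : IsLeftFinite (M : Set ℚ)) (h0 : ∀ q ∈ M, 0 ≤ q)
    {u : ℕ → LCReal} {a : LCReal} (h : CoeffTendsto (fun k => u k * u k) (a * a))
    (hu : ∀ᶠ k in atTop, u k ∈ supported ℝ M) (ha : a ∈ supported ℝ M)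
    (hu0 : ∀ᶠ k in atTop, 0 ≤ coeff (u k) 0) (ha0 : 0 < coeff a 0) : CoeffTendsto u a := by
  have hzero : ∀ q ∉ M, Tendsto (fun k => coeff (u k) q) atTop (𝓝 (coeff a q)) := fun q hq => by
    rw [ha q hq]
    exact tendsto_const_nhds.congr' (hu.mono fun k hk => (hk q hq).symm)
  have hcoeff0 : Tendsto (fun k => coeff (u k) 0) atTop (𝓝 (coeff a 0)) := by
    have hs := (h 0).sqrt
    rw [coeff_mul_zero (.of_mem_supported h0 ha) (.of_mem_supported h0 ha),
      Real.sqrt_mul_self ha0.le] at hs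
    refine hs.congr' ?_
    filter_upwards [hu, hu0] with k h1 h2
    rw [coeff_mul_zero (.of_mem_supported h0 h1) (.of_mem_supported h0 h1), Real.sqrt_mul_self h2]
  -- In the remaining sum both entries are below `q`, so this can be solved for `b[q]` recursively.
  have hsplit : ∀ b ∈ supported ℝ M, ∀ q ∈ M, q ≠ 0 → coeff (b * b) q = 2 * coeff b 0 * coeff b q +
      ∑ ij ∈ ((Finset.antidiagonal hM.isPWO hM.isPWO q).erase (0, q)).erase (q, 0),
        coeff b ij.1 * coeff b ij.2 := by
    intro b hb q hq hq0
    rw [coeff_mul_eq_add hM.isPWO hM.isPWO hb hb M.zero_mem hq,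
      ← Finset.add_sum_erase _ (fun ij : ℚ × ℚ => coeff b ij.1 * coeff b ij.2) (a := (q, 0))
        (by simpa [hq0] using hq)]
    ring
  suffices hmem : ∀ q ∈ (M : Set ℚ), Tendsto (fun k => coeff (u k) q) atTop (𝓝 (coeff a q)) from
    fun q => (em (q ∈ M)).elim (hmem q) (hzero q)
  refine forall_mem_of_isWF hM.isPWO.isWF fun q hq ih => ?_
  rcases eq_or_ne q 0 with rfl | hq0
  · exact hcoeff0
  have ha2 : 2 * coeff a 0 ≠ 0 := (mul_pos two_pos ha0).ne'
  have hsum : Tendsto (fun k => (coeff (u k * u k) q -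
      ∑ ij ∈ ((Finset.antidiagonal hM.isPWO hM.isPWO q).erase (0, q)).erase (q, 0),
        coeff (u k) ij.1 * coeff (u k) ij.2) / (2 * coeff (u k) 0)) atTop
      (𝓝 ((coeff (a * a) q -
      ∑ ij ∈ ((Finset.antidiagonal hM.isPWO hM.isPWO q).erase (0, q)).erase (q, 0),
        coeff a ij.1 * coeff a ij.2) / (2 * coeff a 0))) := by
    refine ((h q).sub (tendsto_finsetSum _ fun ij hij => ?_)).div (hcoeff0.const_mul 2) ha2
    obtain ⟨hne, hij⟩ := Finset.mem_erase.mp hij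
    obtain ⟨h1, h2, h3, -, h5⟩ := snd_lt_of_mem_erase h0 hij
    have h6 : ij.2 ≠ 0 := fun h => hne (Prod.ext (by simpa [h] using h3) h)
    have h7 : ij.1 < q := by have := (h0 _ h2).lt_of_ne' h6; linarith
    exact (ih _ h1 h7).mul (ih _ h2 h5)
  rw [hsplit a ha q hq hq0, add_sub_cancel_right, mul_div_cancel_left₀ _ ha2] at hsum
  refine hsum.congr' ?_
  filter_upwards [hu, hcoeff0.eventually_ne ha0.ne'] with k h1 h2
  rw [hsplit _ h1 q hq hq0, add_sub_cancel_right,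
    mul_div_cancel_left₀ _ (mul_ne_zero two_ne_zero h2)]

/-! ### Absolute value and maximum norm over 𝓒 -/

section Complex

theorem coeff_ofReal (a : LCReal) (q : ℚ) :
    coeff (ofReal a) q = Complex.ofReal (coeff a q) := rfl

theorem coeff_re (z : LCComplex) (q : ℚ) : coeff (re z) q = (coeff z q).re := rfl

theorem coeff_im (z : LCComplex) (q : ℚ) : coeff (im z) q = (coeff z q).im := rfl

theorem ofReal_mul (a b : LCReal) : ofReal (a * b) = ofReal a * ofReal b := ext fun q => by
  have h : ∀ a : LCReal, ∀ q ∉ a.1.support, coeff a q = 0 := fun a q hq => not_not.mp hq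
  rw [coeff_ofReal, coeff_mul a.1.isPWO_support b.1.isPWO_support (h a) (h b),
    coeff_mul a.1.isPWO_support b.1.isPWO_support
      (fun q hq => by rw [coeff_ofReal, h a q hq, Complex.ofReal_zero])
      (fun q hq => by rw [coeff_ofReal, h b q hq, Complex.ofReal_zero])]
  simp [coeff_ofReal]

theorem re_ofReal_mul (a : LCReal) (z : LCComplex) : re (ofReal a * z) = a * re z := ext fun q => by
  have h : ∀ q ∉ a.1.support, coeff a q = 0 := fun q hq => not_not.mp hq
  have h' : ∀ q ∉ z.1.support, coeff z q = 0 := fun q hq => not_not.mp hq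
  rw [coeff_re, coeff_mul a.1.isPWO_support z.1.isPWO_support h
      (fun q hq => by rw [coeff_re, h' q hq, Complex.zero_re]),
    coeff_mul a.1.isPWO_support z.1.isPWO_support
      (fun q hq => by rw [coeff_ofReal, h q hq, Complex.ofReal_zero]) h']
  simp [coeff_ofReal, coeff_re]

theorem im_ofReal_mul (a : LCReal) (z : LCComplex) : im (ofReal a * z) = a * im z := ext fun q => by
  have h : ∀ q ∉ a.1.support, coeff a q = 0 := fun q hq => not_not.mp hq
  have h' : ∀ q ∉ z.1.support, coeff z q = 0 := fun q hq => not_not.mp hq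
  rw [coeff_im, coeff_mul a.1.isPWO_support z.1.isPWO_support h
      (fun q hq => by rw [coeff_im, h' q hq, Complex.zero_im]),
    coeff_mul a.1.isPWO_support z.1.isPWO_support
      (fun q hq => by rw [coeff_ofReal, h q hq, Complex.ofReal_zero]) h']
  simp [coeff_ofReal, coeff_im]

theorem ofReal_one : ofReal 1 = 1 := ext fun q => by
  rw [coeff_ofReal]
  change ((HahnSeries.coeff (1 : HahnSeries ℚ ℝ) q : ℝ) : ℂ) =
    HahnSeries.coeff (1 : HahnSeries ℚ ℂ) q
  rw [HahnSeries.coeff_one, HahnSeries.coeff_one]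
  split_ifs <;> simp

theorem ofReal_zero : ofReal 0 = 0 := ext fun q => by
  rw [coeff_ofReal, coeff_zero, coeff_zero, Complex.ofReal_zero]

theorem ofReal_injective : Function.Injective ofReal := fun _ _ h => ext fun q =>
  Complex.ofReal_injective (congrArg (coeff · q) h)

theorem ofReal_ne_zero {a : LCReal} (h : a ≠ 0) : ofReal a ≠ 0 := fun h' =>
  h (ofReal_injective (h'.trans ofReal_zero.symm))

theorem ofReal_pow (a : LCReal) (k : ℕ) : ofReal (a ^ k) = ofReal a ^ k := by
  induction k with
  | zero => rw [pow_zero, pow_zero, ofReal_one]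
  | succ k ih => rw [pow_succ, pow_succ, ofReal_mul, ih]

theorem ofReal_mem_supported {a : LCReal} (h : a ∈ supported ℝ M) :
    ofReal a ∈ supported ℂ M := fun q hq => by rw [coeff_ofReal, h q hq, Complex.ofReal_zero]

theorem re_mem_supported {z : LCComplex} (h : z ∈ supported ℂ M) :
    re z ∈ supported ℝ M := fun q hq => by rw [coeff_re, h q hq, Complex.zero_re]

theorem im_mem_supported {z : LCComplex} (h : z ∈ supported ℂ M) :
    im z ∈ supported ℝ M := fun q hq => by rw [coeff_im, h q hq, Complex.zero_im]

theorem absC_nonneg (z : LCComplex) : 0 ≤ absC z := sqrt_nonneg _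

theorem absC_mul_self (z : LCComplex) : absC z * absC z = re z * re z + im z * im z := by
  rw [absC, sqrt_mul_self (by positivity), sq, sq]

theorem absC_ofReal_mul {a : LCReal} (ha : 0 ≤ a) (z : LCComplex) :
    absC (ofReal a * z) = a * absC z := by
  refine (mul_self_inj (absC_nonneg _) (mul_nonneg ha (absC_nonneg _))).mp ?_
  rw [mul_mul_mul_comm, absC_mul_self, absC_mul_self, re_ofReal_mul, im_ofReal_mul]
  ring

theorem maxNorm_ofReal_smul {ι : Type*} [Fintype ι] [Nonempty ι] {a : LCReal} (ha : 0 ≤ a)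
    (x : ι → LCComplex) : maxNorm (ofReal a • x) = a * maxNorm x := by
  refine le_antisymm (Finset.sup'_le _ _ fun i _ => ?_) ?_
  · rw [Pi.smul_apply, smul_eq_mul, absC_ofReal_mul ha]
    exact mul_le_mul_of_nonneg_left
      (Finset.le_sup' (fun i => absC (x i)) (Finset.mem_univ i)) ha
  · obtain ⟨i, hi, hmax⟩ := Finset.exists_mem_eq_sup' Finset.univ_nonempty fun i => absC (x i)
    rw [maxNorm, hmax, ← absC_ofReal_mul ha]
    exact Finset.le_sup' (fun i => absC ((ofReal a • x) i)) hi

theorem coeff_absC_mul_self_zero (h0 : ∀ q ∈ M, 0 ≤ q)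
    {z : LCComplex} (hz : z ∈ supported ℂ M) :
    coeff (absC z * absC z) 0 = ‖coeff z 0‖ * ‖coeff z 0‖ := by
  have h1 : AtMostFinite (re z) := .of_mem_supported h0 (re_mem_supported hz)
  have h2 : AtMostFinite (im z) := .of_mem_supported h0 (im_mem_supported hz)
  rw [absC_mul_self, coeff_add, coeff_mul_zero h1 h1, coeff_mul_zero h2 h2, coeff_re, coeff_im,
    Complex.norm_mul_self_eq_normSq, Complex.normSq_apply]

theorem absC_mul_self_mem_supported {z : LCComplex} (hz : z ∈ supported ℂ M) :
    absC z * absC z ∈ supported ℝ M := by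
  rw [absC_mul_self]
  exact add_mem (mul_mem (re_mem_supported hz) (re_mem_supported hz))
    (mul_mem (im_mem_supported hz) (im_mem_supported hz))

/-- Both sides are nonnegative reals with the same square, as the zeroth coefficient is
multiplicative on at most finite elements. -/
theorem coeff_absC_zero (h0 : ∀ q ∈ M, 0 ≤ q)
    {z : LCComplex} (hz : z ∈ supported ℂ M) :
    coeff (absC z) 0 = ‖coeff z 0‖ := by
  have hfin : AtMostFinite (absC z) :=
    .of_mul_self (.of_mem_supported h0 (absC_mul_self_mem_supported hz))
  refine (mul_self_inj (coeff_zero_nonneg hfin (absC_nonneg z)) (norm_nonneg _)).mp ?_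
  rw [← coeff_mul_zero hfin hfin, coeff_absC_mul_self_zero h0 hz]

theorem absC_mem_supported (h0 : ∀ q ∈ M, 0 ≤ q)
    {z : LCComplex} (hz : z ∈ supported ℂ M) (hz0 : coeff z 0 ≠ 0) :
    absC z ∈ supported ℝ M :=
  mem_supported_of_mul_self h0 (absC_mul_self_mem_supported hz)
    (by rw [coeff_absC_zero h0 hz]; exact norm_ne_zero_iff.mpr hz0)

/-- The difference of the squares is at most finite with positive zeroth coefficient, hence
positive. -/
theorem absC_lt_absC (h0 : ∀ q ∈ M, 0 ≤ q)
    {y z : LCComplex} (hy : y ∈ supported ℂ M) (hz : z ∈ supported ℂ M)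
    (h : ‖coeff y 0‖ < ‖coeff z 0‖) : absC y < absC z := by
  refine lt_of_mul_self_lt_mul_self₀ (absC_nonneg z) (sub_pos.mp (pos_of_coeff_zero_pos ?_ ?_))
  · exact .of_mem_supported h0
      (sub_mem (absC_mul_self_mem_supported hz) (absC_mul_self_mem_supported hy))
  · rw [coeff_sub, coeff_absC_mul_self_zero h0 hy, coeff_absC_mul_self_zero h0 hz, sub_pos]
    exact mul_self_lt_mul_self (norm_nonneg _) h

theorem maxNorm_eq_absC (h0 : ∀ q ∈ M, 0 ≤ q)
    {ι : Type*} [Fintype ι] [Nonempty ι] {x : ι → LCComplex} {i₀ : ι}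
    (hx : ∀ i, x i ∈ supported ℂ M) (h : ∀ i, i ≠ i₀ → ‖coeff (x i) 0‖ < ‖coeff (x i₀) 0‖) :
    maxNorm x = absC (x i₀) := by
  refine le_antisymm (Finset.sup'_le _ _ fun i _ => ?_)
    (Finset.le_sup' (fun i => absC (x i)) (Finset.mem_univ i₀))
  rcases eq_or_ne i i₀ with rfl | hi
  · exact le_rfl
  · exact (absC_lt_absC h0 (hx i) (hx i₀) (h i hi)).le

/-- The square of the modulus is polynomial in real and imaginary parts; `CoeffTendsto.of_mul_self`
then takes the root. -/
theorem CoeffTendsto.absC (h0 : ∀ q ∈ M, 0 ≤ q)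
    (hM : IsLeftFinite (M : Set ℚ)) {u : ℕ → LCComplex} {a : LCComplex}
    (h : CoeffTendsto u a) (hu : ∀ k, u k ∈ supported ℂ M) (ha : a ∈ supported ℂ M)
    (ha0 : coeff a 0 ≠ 0) : CoeffTendsto (fun k => absC (u k)) (absC a) := by
  have hre : CoeffTendsto (fun k => re (u k)) (re a) :=
    fun q => (Complex.continuous_re.tendsto _).comp (h q)
  have him : CoeffTendsto (fun k => im (u k)) (im a) :=
    fun q => (Complex.continuous_im.tendsto _).comp (h q)
  refine .of_mul_self hM h0 ?_ ?_ (absC_mem_supported h0 ha ha0) (.of_forall fun k => ?_) ?_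
  · simp only [absC_mul_self]
    exact (hre.mul hM hre (fun k => re_mem_supported (hu k)) (fun k => re_mem_supported (hu k))
      (re_mem_supported ha) (re_mem_supported ha)).add
      (him.mul hM him (fun k => im_mem_supported (hu k)) (fun k => im_mem_supported (hu k))
      (im_mem_supported ha) (im_mem_supported ha))
  · filter_upwards [(h 0).eventually_ne ha0] with k hk
    exact absC_mem_supported h0 (hu k) hk
  · rw [coeff_absC_zero h0 (hu k)]
    exact norm_nonneg _
  · rw [coeff_absC_zero h0 ha]
    exact norm_pos_iff.mpr ha0

/-- If the zeroth coefficient of the limit has a unique coordinate of largest absolute value, then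
normalization by the maximum norm preserves coefficientwise convergence. -/
theorem weakLimit_div_maxNorm (h0 : ∀ q ∈ M, 0 ≤ q)
    (hM : IsLeftFinite (M : Set ℚ)) {ι : Type*} [Fintype ι] [Nonempty ι]
    {u : ℕ → ι → LCComplex} {a : ι → LCComplex} {i₀ : ι}
    (h : ∀ i, CoeffTendsto (fun k => u k i) (a i)) (hu : ∀ k i, u k i ∈ supported ℂ M)
    (ha : ∀ i, a i ∈ supported ℂ M) (ha0 : coeff (a i₀) 0 ≠ 0)
    (hmax : ∀ i, i ≠ i₀ → ‖coeff (a i) 0‖ < ‖coeff (a i₀) 0‖) (i : ι) :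
    WeakLimit (fun k => u k i / ofReal (maxNorm (u k))) (a i / ofReal (maxNorm a)) := by
  have hev0 : ∀ᶠ k in atTop, coeff (u k i₀) 0 ≠ 0 := (h i₀ 0).eventually_ne ha0
  have hev : ∀ᶠ k in atTop, maxNorm (u k) = absC (u k i₀) := by
    -- Finitely many strict inequalities between limits persist for large `k`.
    have : ∀ᶠ k in atTop, ∀ i, i ≠ i₀ → ‖coeff (u k i) 0‖ < ‖coeff (u k i₀) 0‖ := by
      refine eventually_all.mpr fun i => ?_
      by_cases hi : i = i₀
      · exact .of_forall fun _ h => absurd hi h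
      · exact ((h i 0).norm.eventually_lt (h i₀ 0).norm (hmax i hi)).mono fun _ h _ => h
    exact this.mono fun k hk => maxNorm_eq_absC h0 (hu k) hk
  have hs0 : ∀ z ∈ supported ℂ M, coeff z 0 ≠ 0 → coeff (ofReal (absC z)) 0 ≠ 0 :=
      fun z hz hz0 => by
    rw [coeff_ofReal, coeff_absC_zero h0 hz]
    exact_mod_cast norm_ne_zero_iff.mpr hz0
  have hne : ∀ z ∈ supported ℂ M, coeff z 0 ≠ 0 → ofReal (absC z) ≠ 0 := fun z hz hz0 h =>
    hs0 z hz hz0 (by rw [h, coeff_zero])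
  have hmem : ∀ y ∈ supported ℂ M, ∀ z ∈ supported ℂ M, coeff z 0 ≠ 0 →
      y / ofReal (absC z) ∈ supported ℂ M := fun y hy z hz hz0 =>
    mem_supported_of_mul hM h0 (ofReal_mem_supported (absC_mem_supported h0 hz hz0))
      (by rwa [mul_div_cancel₀ _ (hne z hz hz0)]) (hs0 z hz hz0)
  have hdiv : ∀ᶠ k in atTop, u k i / ofReal (maxNorm (u k)) ∈ supported ℂ M := by
    filter_upwards [hev0, hev] with k h1 h2
    rw [h2]
    exact hmem _ (hu k i) _ (hu k i₀) h1
  rw [maxNorm_eq_absC h0 ha hmax]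
  refine CoeffTendsto.weakLimit hM ?_ hdiv (hmem _ (ha i) _ (ha i₀) ha0)
  have hs : CoeffTendsto (fun k => ofReal (absC (u k i₀))) (ofReal (absC (a i₀))) := fun q =>
    (Complex.continuous_ofReal.tendsto _).comp
      (((h i₀).absC h0 hM (fun k => hu k i₀) (ha i₀) ha0) q)
  refine hs.of_mul hM h0 (fun q => ?_) ?_ hdiv
    (ofReal_mem_supported (absC_mem_supported h0 (ha i₀) ha0)) (hmem _ (ha i) _ (ha i₀) ha0)
    (hs0 _ (ha i₀) ha0)
  · rw [mul_div_cancel₀ _ (hne _ (ha i₀) ha0)]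
    refine (h i q).congr' ?_
    filter_upwards [hev0, hev] with k h1 h2
    rw [h2, mul_div_cancel₀ _ (hne _ (hu k i₀) h1)]
  · filter_upwards [hev0] with k hk
    exact ofReal_mem_supported (absC_mem_supported h0 (hu k i₀) hk)

end Complex

/-! ### Eigenvectors, common supports and the power iteration -/

theorem pow_mulVec_eq_smul {ι F : Type*} [Fintype ι] [DecidableEq ι] [Field F] {A : Matrix ι ι F}
    {c : F} {v : ι → F} (h : A.mulVec v = c • v) (k : ℕ) : (A ^ k).mulVec v = c ^ k • v := by
  induction k with
  | zero => simp
  | succ k ih =>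
    rw [pow_succ, ← Matrix.mulVec_mulVec, h, Matrix.mulVec_smul, ih, smul_smul, pow_succ']

/-- Finitely many at most finite elements have their supports in a common left-finite monoid of
nonnegative exponents. -/
theorem exists_supported {ι κ K L : Type*} [Finite ι] [Finite κ] [Field K] [Field L]
    (f : ι → leviCivita K) (g : κ → leviCivita L) (hf : ∀ i, AtMostFinite (f i))
    (hg : ∀ i, AtMostFinite (g i)) :
    ∃ M : AddSubmonoid ℚ, IsLeftFinite (M : Set ℚ) ∧ (∀ q ∈ M, 0 ≤ q) ∧
      (∀ i, f i ∈ supported K M) ∧ ∀ i, g i ∈ supported L M := by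
  set S : Set ℚ := (⋃ i, (f i).1.support) ∪ ⋃ i, (g i).1.support
  have hS : IsLeftFinite S :=
    (IsLeftFinite.iUnion fun i => (f i).2).union (IsLeftFinite.iUnion fun i => (g i).2)
  have hS0 : ∀ q ∈ S, 0 ≤ q := by
    rintro q (hq | hq) <;> obtain ⟨i, hi⟩ := Set.mem_iUnion.mp hq <;> by_contra hneg
    · exact hi (atMostFinite_iff.mp (hf i) q (not_le.mp hneg))
    · exact hi (atMostFinite_iff.mp (hg i) q (not_le.mp hneg))
  refine ⟨AddSubmonoid.closure S, hS.addSubmonoid_closure hS0, fun q hq => ?_,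
    fun i q hq => ?_, fun i q hq => ?_⟩
  · exact (AddSubmonoid.closure_le (S := AddSubmonoid.nonneg ℚ)).mpr hS0 hq
  · by_contra h
    exact hq (AddSubmonoid.subset_closure (Or.inl (Set.mem_iUnion.mpr ⟨i, h⟩)))
  · by_contra h
    exact hq (AddSubmonoid.subset_closure (Or.inr (Set.mem_iUnion.mpr ⟨i, h⟩)))

end LeviCivita
end

open LeviCivita in
theorem theorem4p4 {n : ℕ} [NeZero n] (A : Matrix (Fin n) (Fin n) LCComplex)
    (hA : IsDiagonalizable A)
    -- the eigenvalues of `A`, listed with multiplicity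
    (ν : Fin n → LCReal)
    (hν : A.charpoly.roots = Finset.univ.val.map fun j => ofReal (ν j))
    (hν_fin : ∀ j, AtMostFinite (ν j))
    (hν_one : coeff (ν 0) 0 = 1)
    (hν_lt : ∀ j, j ≠ 0 → |coeff (ν j) 0| < 1)
    (hν_anti : ∀ i j, i ≠ 0 → i ≤ j → |coeff (ν j) 0| ≤ |coeff (ν i) 0|)
    (x : Fin n → LCComplex) (w : Fin n → Fin n → LCComplex)
    (hx : x = ∑ j, w j)
    (hw : ∀ j, A.mulVec (w j) = ofReal (ν j) • w j)
    (hw_fin : ∀ j i, AtMostFinite (w j i))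
    (hw_ne : ∃ i, coeff (w 0 i) 0 ≠ 0)
    (hmax : ∃! i₀, ∀ i, ‖coeff (w 0 i) 0‖ ≤ ‖coeff (w 0 i₀) 0‖) :
    ∀ i, WeakLimit
      (fun k : ℕ => (A ^ k).mulVec x i / ofReal (maxNorm ((A ^ k).mulVec x)))
      (w 0 i / ofReal (maxNorm (w 0))) := by
  obtain ⟨M, hM, h0, hνM, hwM⟩ := exists_supported ν (fun ji : Fin n × Fin n => w ji.1 ji.2)
    hν_fin fun ji => hw_fin ji.1 ji.2
  obtain ⟨i₀, hi₀, huniq⟩ := hmax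
  -- A coordinate tying with `i₀` would be a second maximizer.
  have hmax' : ∀ i, i ≠ i₀ → ‖coeff (w 0 i) 0‖ < ‖coeff (w 0 i₀) 0‖ := fun i hi => by
    by_contra hge
    exact hi (huniq i fun j => (hi₀ j).trans (not_lt.mp hge))
  have hwi₀ : coeff (w 0 i₀) 0 ≠ 0 := by
    obtain ⟨i, hi⟩ := hw_ne
    exact norm_pos_iff.mp ((norm_pos_iff.mpr hi).trans_le (hi₀ i))
  have hν0 : 0 < ν 0 := pos_of_coeff_zero_pos (hν_fin 0) (by rw [hν_one]; exact one_pos)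
  set μ : Fin n → LCReal := fun j => ν j / ν 0
  have hμν : ∀ j, ν 0 * μ j = ν j := fun j => mul_div_cancel₀ _ hν0.ne'
  have hμM : ∀ j, μ j ∈ supported ℝ M := fun j =>
    mem_supported_of_mul hM h0 (hνM 0) (by rw [hμν]; exact hνM j) (by rw [hν_one]; exact one_ne_zero)
  have hμM' : ∀ j, ofReal (μ j) ∈ supported ℂ M := fun j => ofReal_mem_supported (hμM j)
  have hμ_lt : ∀ j, j ≠ 0 → ‖coeff (ofReal (μ j)) 0‖ < 1 := fun j hj => by
    have h := coeff_mul_zero (hν_fin 0) (.of_mem_supported h0 (hμM j))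
    rw [hμν, hν_one, one_mul] at h
    rw [coeff_ofReal, Complex.norm_real, Real.norm_eq_abs, ← h]
    exact hν_lt j hj
  set y : ℕ → Fin n → LCComplex := fun k i => ∑ j, ofReal (μ j) ^ k * w j i
  have hAy : ∀ k, (A ^ k).mulVec x = ofReal (ν 0 ^ k) • y k := fun k => by
    rw [hx, Matrix.mulVec_sum]
    ext1 i
    simp only [Finset.sum_apply, Pi.smul_apply, y, pow_mulVec_eq_smul (hw _) k, smul_eq_mul,
      Finset.mul_sum]
    refine Finset.sum_congr rfl fun j _ => ?_
    rw [← hμν j, ofReal_mul, mul_pow, ofReal_pow, mul_assoc]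
  have hyM : ∀ k i, y k i ∈ supported ℂ M := fun k i =>
    sum_mem fun j _ => mul_mem (pow_mem (hμM' j) k) (hwM (j, i))
  have hylim : ∀ i, CoeffTendsto (fun k => y k i) (w 0 i) := fun i => by
    -- The dominant term is constant because `μ 0 = 1`; the others decay.
    have hterm : ∀ j ∈ Finset.univ, CoeffTendsto (fun k => ofReal (μ j) ^ k * w j i)
        (if j = 0 then w 0 i else 0) := fun j _ => by
      split_ifs with hj
      · have h1 : μ 0 = 1 := div_self hν0.ne'
        simp only [hj, h1, ofReal_one, one_pow, one_mul]
        exact .const _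
      · rw [← zero_mul (w j i)]
        exact (CoeffTendsto.pow hM h0 (hμM' j) (hμ_lt j hj)).mul hM (.const _)
          (pow_mem (hμM' j)) (fun _ => hwM (j, i)) (zero_mem _) (hwM (j, i))
    simpa using CoeffTendsto.sum hterm
  intro i
  have hquot : ∀ k, (A ^ k).mulVec x i / ofReal (maxNorm ((A ^ k).mulVec x)) =
      y k i / ofReal (maxNorm (y k)) := fun k => by
    have hk := pow_pos hν0 k
    rw [hAy, maxNorm_ofReal_smul hk.le, ofReal_mul, Pi.smul_apply, smul_eq_mul,
      mul_div_mul_left _ _ (ofReal_ne_zero hk.ne')]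
  simp only [hquot]
  exact weakLimit_div_maxNorm h0 hM hylim hyM (fun i => hwM (0, i)) hwi₀ hmax' i
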